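/- Let $G$ be an arbitrary (not necessarily finite) group that is generated by an abelian normal subgroup $A$ together with an element $t$ such that $t^2\in A$ and $t^{-1}at=a^{-1}$ for every $a\in A$. Let $U_1(\mathbb{Z}G)$ be the group of units of augmentation one of the integral group ring $\mathbb{Z}G$, and for $\alpha=\sum_{g\in G}\alpha(g)g\in\mathbb{Z}G$ and $g\in G$ put $\tilde\alpha(g)=\sum_{h\in C_g}\alpha(h)$, where $C_g$ is the conjugacy class of $g$ in $G$. Then $G$ is a $p$-UT group for every prime $p$; that is, for every prime $p$ and every $\alpha\in U_1(\mathbb{Z}G)$ whose order is a power of $p$, $\alpha$ has the unique trace property: there exists an element $g\in G$, unique up to conjugacy, such that $\tilde\alpha(g)\neq 0$. -/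

import Mathlib

namespace GroupRing

/-- The augmentation map `ℤG → ℤ`, `∑ α(g) g ↦ ∑ α(g)`. -/
noncomputable def augmentation (G : Type*) [Group G] : MonoidAlgebra ℤ G →ₐ[ℤ] ℤ :=
  MonoidAlgebra.lift ℤ ℤ G (1 : G →* ℤ)

theorem augmentation_apply {G : Type*} [Group G] (α : MonoidAlgebra ℤ G) :
    augmentation G α = α.coeff.sum fun _ n => n := by
  simp [augmentation, MonoidAlgebra.lift_apply]

/-- The group of units of augmentation one of the integral group ring `ℤG`. -/
noncomputable def normalizedUnits (G : Type*) [Group G] : Subgroup (MonoidAlgebra ℤ G)ˣ :=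
  (Units.map (augmentation G : MonoidAlgebra ℤ G →* ℤ)).ker

theorem mem_normalizedUnits {G : Type*} [Group G] (α : (MonoidAlgebra ℤ G)ˣ) :
    α ∈ normalizedUnits G ↔ augmentation G (α : MonoidAlgebra ℤ G) = 1 := by
  simp [normalizedUnits, MonoidHom.mem_ker, Units.ext_iff]

open Classical in
/-- The sum of the coefficients of `α` over the conjugacy class of `g`. The class may be infinite,
but only the finitely many elements of the support of `α` contribute. -/
noncomputable def classTrace {G : Type*} [Group G] (α : MonoidAlgebra ℤ G) (g : G) : ℤ :=
  ∑ h ∈ α.coeff.support with IsConj g h, α.coeff h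

/-- There is an element `g`, unique up to conjugacy, with nonzero class trace. -/
def HasUniqueTrace {G : Type*} [Group G] (α : MonoidAlgebra ℤ G) : Prop :=
  ∃ g : G, classTrace α g ≠ 0 ∧ ∀ h : G, classTrace α h ≠ 0 → IsConj g h

/-- Every unit of augmentation one whose order is a power of `p` has the unique trace property. -/
def IsPUT (p : ℕ) (G : Type*) [Group G] : Prop :=
  ∀ α ∈ normalizedUnits G, (∃ n : ℕ, orderOf α = p ^ n) →
    HasUniqueTrace (α : MonoidAlgebra ℤ G)

end GroupRing

/-! Let `α ^ n = 1` with augmentation one. Every complex character of an abelian image of `G` sends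
`α` to a root of unity, so by Parseval the squared coefficients of that image sum to at most 1 and
the image is a single element. This settles abelian `G`.

Otherwise `A` has index two. A conjugacy class outside `A` is a full fibre of `G → G^ab`, so the
traces there are read off the single element `g` that is the image of `α`. Inside `A` the classes
are `{a, a⁻¹}`; put `f a = α a + α a⁻¹`. For a character `χ` of `A`, `∑ f a * χ a` is the trace of
`α` in the induced two-dimensional representation, of norm at most 2, so `∑ f a ^ 2 ≤ 4`. Each class
meeting the support contributes at least 2. The total of `f` is 2 if `g ∈ A` and 0 if not. Two
classes would force total `4`, `0` or `-4` and squares summing to exactly 4: the first excludes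
total 2, and the strict bound from the trivial character excludes total 0. -/

open MeasureTheory

/-! ### Fourier analysis on discrete abelian groups -/

/-- Characters with values in the circle separate the points of an abelian group. -/
theorem exists_circle_character_apply_ne_one {B : Type*} [CommGroup B] {b : B} (hb : b ≠ 1) :
    ∃ χ : B →* Circle, χ b ≠ 1 := by
  obtain ⟨c, hc⟩ := CharacterModule.exists_character_apply_ne_zero_of_ne_zero
    (A := Additive B) (a := Additive.ofMul b) (by simpa using hb)
  -- Characters into `ℚ/ℤ` already separate points; the injection into `ℝ/ℤ` carries them to the
  -- circle.
  let ι : AddCircle (1 : ℚ) →+ AddCircle (1 : ℝ) :=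
    QuotientAddGroup.map _ _ (Rat.castHom ℝ).toAddMonoidHom (by
      rintro x hx
      obtain ⟨n, rfl⟩ := AddSubgroup.mem_zmultiples_iff.1 hx
      exact AddSubgroup.mem_zmultiples_iff.2 ⟨n, by simp⟩)
  have hι : ∀ x, ι x = 0 → x = 0 := by
    intro x
    induction x using QuotientAddGroup.induction_on with
    | H z =>
      intro h
      have h' : ((z : ℝ) : AddCircle (1 : ℝ)) = 0 := h
      rw [AddCircle.coe_eq_zero_iff] at h'
      obtain ⟨n, hn⟩ := h'
      refine (AddCircle.coe_eq_zero_iff (1 : ℚ)).2 ⟨n, ?_⟩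
      have : (n : ℝ) = (z : ℝ) := by simpa using hn
      simpa using (by exact_mod_cast this : (n : ℚ) = z)
  refine ⟨{ toFun := fun x => AddCircle.toCircle (ι (c (Additive.ofMul x)))
            map_one' := by simp
            map_mul' := fun x y => by simp [AddCircle.toCircle_add] }, fun h => hc (hι _ ?_)⟩
  refine AddCircle.injective_toCircle one_ne_zero ?_
  rw [AddCircle.toCircle_zero]
  exact h

theorem PontryaginDual.continuous_eval_const {B : Type*} [CommGroup B] [TopologicalSpace B]
    (b : B) :
    Continuous fun χ : PontryaginDual B => (χ b : ℂ) :=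
  continuous_subtype_val.comp
    (ContinuousEvalConst.continuous_eval_const (F := B →ₜ* Circle) b)

section Parseval

variable {B : Type*} [CommGroup B] [TopologicalSpace B] [DiscreteTopology B]
  [MeasurableSpace (PontryaginDual B)] [BorelSpace (PontryaginDual B)]

theorem PontryaginDual.integral_apply [DecidableEq B] (μ : Measure (PontryaginDual B))
    [IsProbabilityMeasure μ] [μ.IsMulLeftInvariant] (b : B) :
    ∫ χ : PontryaginDual B, (χ b : ℂ) ∂μ = if b = 1 then 1 else 0 := by
  split_ifs with hb
  · simp [hb]
  · obtain ⟨ψ, hψ⟩ := exists_circle_character_apply_ne_one hb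
    let ψ' : PontryaginDual B := ⟨ψ, continuous_of_discreteTopology⟩
    -- Translation by `ψ` multiplies the integral by `ψ b ≠ 1`, so it vanishes.
    have h := integral_mul_left_eq_self (μ := μ) (fun χ : PontryaginDual B => (χ b : ℂ)) ψ'
    have h2 : ∀ χ : PontryaginDual B, (((ψ' * χ) b : Circle) : ℂ) = (ψ b : ℂ) * (χ b : ℂ) :=
      fun χ => rfl
    simp only [h2, integral_const_mul] at h
    have h3 : ((ψ b : ℂ) - 1) * ∫ χ : PontryaginDual B, (χ b : ℂ) ∂μ = 0 := by
      rw [sub_mul, h]; ring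
    refine (mul_eq_zero.1 h3).resolve_left fun h4 => hψ ?_
    exact Circle.ext (by simpa using sub_eq_zero.1 h4)

theorem PontryaginDual.integral_norm_sq (μ : Measure (PontryaginDual B))
    [IsProbabilityMeasure μ] [μ.IsMulLeftInvariant] (f : B →₀ ℤ) :
    ∫ χ : PontryaginDual B, ‖f.sum fun b n => (n : ℂ) * χ b‖ ^ 2 ∂μ =
      ((f.sum fun _ n => n ^ 2 : ℤ) : ℝ) := by
  classical
  have key : ∀ χ : PontryaginDual B, ((‖f.sum fun b n => (n : ℂ) * χ b‖ ^ 2 : ℝ) : ℂ) =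
      ∑ a ∈ f.support, ∑ b ∈ f.support, ((f a : ℂ) * f b) * (χ (a * b⁻¹) : ℂ) := by
    intro χ
    have hmap : ∀ a b : B, (χ (a * b⁻¹) : ℂ) = χ a * (starRingEnd ℂ) (χ b) := fun a b => by
      have h : χ (a * b⁻¹) = χ a * (χ b)⁻¹ := by rw [_root_.map_mul χ, map_inv χ]
      rw [← Circle.coe_inv_eq_conj, ← Circle.coe_mul, ← h]
    push_cast
    rw [← Complex.mul_conj', Finsupp.sum, map_sum, Finset.sum_mul_sum]
    refine Finset.sum_congr rfl fun a _ => Finset.sum_congr rfl fun b _ => ?_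
    rw [hmap, _root_.map_mul (starRingEnd ℂ), map_intCast]
    ring
  have hint : ∀ b : B, Integrable (fun χ : PontryaginDual B => (χ b : ℂ)) μ := fun b =>
    (PontryaginDual.continuous_eval_const b).integrable_of_hasCompactSupport
      (HasCompactSupport.of_compactSpace _)
  have : ((∫ χ : PontryaginDual B, ‖f.sum fun b n => (n : ℂ) * χ b‖ ^ 2 ∂μ : ℝ) : ℂ) =
      ((f.sum fun _ n => n ^ 2 : ℤ) : ℂ) := by
    rw [← integral_complex_ofReal]
    simp only [key]
    rw [integral_finsetSum _ fun a _ => integrable_finsetSum _ fun b _ => (hint _).const_mul _]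
    rw [Finsupp.sum, Int.cast_sum]
    refine Finset.sum_congr rfl fun a ha => ?_
    rw [integral_finsetSum _ fun b _ => (hint _).const_mul _, Finset.sum_eq_single a]
    · rw [integral_const_mul, PontryaginDual.integral_apply]
      simp [sq]
    · intro b _ hb
      rw [integral_const_mul, PontryaginDual.integral_apply,
        if_neg (fun h => hb (mul_inv_eq_one.1 h).symm), mul_zero]
    · exact fun h => absurd ha h
  exact Complex.ofReal_injective (by rw [this]; norm_cast)

end Parseval

/-- A Fourier bound on the characters of an abelian group bounds the sum of the squares of the
coefficients, strictly if the bound at the trivial character is strict. -/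
theorem Finsupp.sum_sq_le_of_norm_character_le {B : Type*} [CommGroup B] (f : B →₀ ℤ) {C : ℝ}
    (hf : ∀ χ : B →* Circle, ‖f.sum fun b n => (n : ℂ) * χ b‖ ≤ C) :
    ((f.sum fun _ n => n ^ 2 : ℤ) : ℝ) ≤ C ^ 2 ∧
      (‖f.sum fun _ n => (n : ℂ)‖ < C → ((f.sum fun _ n => n ^ 2 : ℤ) : ℝ) < C ^ 2) := by
  let _ : TopologicalSpace B := ⊥
  have _ : DiscreteTopology B := ⟨rfl⟩
  let _ : MeasurableSpace (PontryaginDual B) := borel _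
  have _ : BorelSpace (PontryaginDual B) := ⟨rfl⟩
  let μ : Measure (PontryaginDual B) := Measure.haarMeasure ⊤
  have _ : IsProbabilityMeasure μ := ⟨Measure.haarMeasure_self (K₀ := ⊤)⟩
  have hcont' : Continuous fun χ : PontryaginDual B =>
      ‖f.sum fun b n => (n : ℂ) * χ b‖ ^ 2 :=
    Continuous.pow (Continuous.norm (continuous_finsetSum _ fun b _ =>
      continuous_const.mul (PontryaginDual.continuous_eval_const b))) 2
  have hcont : Continuous fun χ : PontryaginDual B =>
      C ^ 2 - ‖f.sum fun b n => (n : ℂ) * χ b‖ ^ 2 := continuous_const.sub hcont'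
  have hnonneg : ∀ χ : PontryaginDual B,
      0 ≤ C ^ 2 - ‖f.sum fun b n => (n : ℂ) * χ b‖ ^ 2 := fun χ =>
    sub_nonneg.2 (pow_le_pow_left₀ (norm_nonneg _) (hf (χ : B →* Circle)) 2)
  have hval : ∫ χ : PontryaginDual B, (C ^ 2 - ‖f.sum fun b n => (n : ℂ) * χ b‖ ^ 2) ∂μ =
      C ^ 2 - ((f.sum fun _ n => n ^ 2 : ℤ) : ℝ) := by
    rw [integral_sub (integrable_const _) (hcont'.integrable_of_hasCompactSupport
      (HasCompactSupport.of_compactSpace _)), PontryaginDual.integral_norm_sq]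
    simp
  constructor
  · have := integral_nonneg (μ := μ) (f := fun χ : PontryaginDual B =>
      C ^ 2 - ‖f.sum fun b n => (n : ℂ) * χ b‖ ^ 2) hnonneg
    linarith [hval]
  · intro h
    -- The integrand is continuous and positive at the trivial character, and Haar measure charges
    -- open sets.
    have := integral_pos_of_integrable_nonneg_nonzero (μ := μ) (x := 1) hcont
      (hcont.integrable_of_hasCompactSupport (HasCompactSupport.of_compactSpace _)) hnonneg (by
        have : ‖f.sum fun b n => (n : ℂ) * ((1 : PontryaginDual B) b : ℂ)‖ ^ 2 < C ^ 2 := by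
          refine pow_lt_pow_left₀ ?_ (norm_nonneg _) two_ne_zero
          simpa using h
        exact (sub_pos.2 this).ne')
    linarith [hval]

/-! ### Torsion units in matrix and abelian images -/

/-- The trace of a complex matrix of finite order is bounded by its size. -/
theorem Matrix.norm_trace_le_of_pow_eq_one {ι : Type*} [Fintype ι] [DecidableEq ι]
    (M : Matrix ι ι ℂ) {n : ℕ} (hn : n ≠ 0) (hM : M ^ n = 1) :
    ‖M.trace‖ ≤ Fintype.card ι := by
  have hroot : ∀ r ∈ M.charpoly.roots, ‖r‖ = 1 := by
    intro r hr
    have hmem : r ∈ spectrum ℂ M :=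
      Matrix.mem_spectrum_iff_isRoot_charpoly.2 (Polynomial.isRoot_of_mem_roots hr)
    have hpow : r ^ n ∈ spectrum ℂ (M ^ n) := spectrum.pow_mem_pow M n hmem
    rw [hM] at hpow
    have : r ^ n = 1 := by
      by_contra h
      refine hpow ?_
      rw [spectrum.mem_resolventSet_iff]
      rw [← map_one (algebraMap ℂ (Matrix ι ι ℂ)), ← map_sub]
      exact (isUnit_iff_ne_zero.2 (sub_ne_zero.2 h)).map _
    exact Complex.norm_eq_one_of_pow_eq_one this hn
  rw [Matrix.trace_eq_sum_roots_charpoly]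
  calc ‖M.charpoly.roots.sum‖ ≤ (M.charpoly.roots.map fun r => ‖r‖).sum :=
        norm_multiset_sum_le _
    _ = (M.charpoly.roots.map fun _ => (1 : ℝ)).sum := by
        rw [Multiset.map_congr rfl hroot]
    _ = Multiset.card M.charpoly.roots := by simp
    _ ≤ Fintype.card ι := by
        rw [← Matrix.charpoly_natDegree_eq_dim M]
        exact_mod_cast Polynomial.card_roots' _

theorem Finsupp.eq_single_of_sum_sq_le_one {ι : Type*} (f : ι →₀ ℤ)
    (hsq : (f.sum fun _ n => n ^ 2) ≤ 1) (hsum : (f.sum fun _ n => n) = 1) :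
    ∃ i, f = Finsupp.single i 1 := by
  have : Nonempty ι := by
    by_contra h
    rw [not_nonempty_iff] at h
    simp [Subsingleton.elim f 0] at hsum
  have hcard : f.support.card ≤ 1 := by
    have : (f.support.card : ℤ) ≤ 1 := by
      refine le_trans ?_ hsq
      rw [Finset.card_eq_sum_ones, Nat.cast_sum, Finsupp.sum]
      refine Finset.sum_le_sum fun i hi => ?_
      have := Int.one_le_abs (Finsupp.mem_support_iff.1 hi)
      push_cast
      rw [← sq_abs]
      nlinarith
    exact_mod_cast this
  rcases Finsupp.card_support_le_one'.1 hcard with ⟨i, n, rfl⟩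
  refine ⟨i, ?_⟩
  rw [Finsupp.sum_single_index rfl] at hsum
  rw [hsum]

/-- A torsion unit of augmentation one maps to a single group element in the integral group ring
of any abelian image. -/
theorem GroupRing.exists_mapDomain_eq_single {G B : Type*} [Group G] [CommGroup B] (φ : G →* B)
    {α : MonoidAlgebra ℤ G} {n : ℕ} (hn : n ≠ 0) (hα : α ^ n = 1)
    (haug : GroupRing.augmentation G α = 1) :
    ∃ b : B, α.coeff.mapDomain φ = Finsupp.single b 1 := by
  have hsum : ((α.coeff.mapDomain φ).sum fun _ n => n) = 1 := by
    rw [Finsupp.sum_mapDomain_index (fun _ => rfl) (fun _ _ _ => rfl),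
      ← GroupRing.augmentation_apply, haug]
  refine Finsupp.eq_single_of_sum_sq_le_one _ ?_ hsum
  have h := (Finsupp.sum_sq_le_of_norm_character_le (α.coeff.mapDomain φ) (C := 1) ?_).1
  · exact_mod_cast (by simpa using h :
      (((α.coeff.mapDomain φ).sum fun _ n => n ^ 2 : ℤ) : ℝ) ≤ 1)
  · intro χ
    rw [Finsupp.sum_mapDomain_index (fun _ => by simp) (fun _ _ _ => by push_cast; ring)]
    have : (α.coeff.sum fun g n => (n : ℂ) * χ (φ g)) =
        MonoidAlgebra.lift ℤ ℂ G ((Circle.coeHom.comp χ).comp φ) α := by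
      rw [MonoidAlgebra.lift_apply]
      simp only [zsmul_eq_mul]
      rfl
    rw [this]
    refine (Complex.norm_eq_one_of_pow_eq_one (n := n) ?_ hn).le
    rw [← map_pow, hα, map_one]

/-- Taking `F` to be an indicator function computes any sum of coefficients over a set that is a
union of fibres of `φ`. -/
theorem GroupRing.exists_sum_mul_eq {G B : Type*} [Group G] [CommGroup B] (φ : G →* B)
    (hφ : Function.Surjective φ) {α : MonoidAlgebra ℤ G} {n : ℕ} (hn : n ≠ 0) (hα : α ^ n = 1)
    (haug : GroupRing.augmentation G α = 1) :
    ∃ g : G, ∀ F : B → ℤ, (α.coeff.sum fun h n => n * F (φ h)) = F (φ g) := by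
  obtain ⟨b, hb⟩ := GroupRing.exists_mapDomain_eq_single φ hn hα haug
  obtain ⟨g, rfl⟩ := hφ b
  refine ⟨g, fun F => ?_⟩
  rw [← Finsupp.sum_mapDomain_index (h := fun b n => n * F b) (by simp)
    (fun _ _ _ => by ring), hb, Finsupp.sum_single_index (by simp), one_mul]

open Classical in
theorem GroupRing.classTrace_eq_sum {G : Type*} [Group G] (α : MonoidAlgebra ℤ G) (g : G) :
    GroupRing.classTrace α g = α.coeff.sum fun h n => n * if IsConj g h then 1 else 0 := by
  simp [GroupRing.classTrace, Finsupp.sum, Finset.sum_filter]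

/-! ### Symmetric integer functions with small square sum -/

namespace Finsupp

theorem sum_sq_subset_le {A : Type*} {f : A →₀ ℤ} (S : Finset A) : ∑ a ∈ S, f a ^ 2 ≤ f.sum fun _ n => n ^ 2 := by
  classical
  calc ∑ a ∈ S, f a ^ 2 ≤ ∑ a ∈ f.support ∪ S, f a ^ 2 :=
        Finset.sum_le_sum_of_subset_of_nonneg Finset.subset_union_right fun _ _ _ => sq_nonneg _
    _ = f.sum fun _ n => n ^ 2 := by
        refine (Finset.sum_subset Finset.subset_union_left fun a _ ha => ?_).symm
        simp [Finsupp.notMem_support_iff.1 ha]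

variable {A : Type*} [CommGroup A] {f : A →₀ ℤ}

/-- A genuine pair counts a nonzero square twice; where `b = b⁻¹`, evenness gives at least 4. -/
theorem two_le_sum_sq_pair [DecidableEq A] (hinv : ∀ a, f a⁻¹ = f a)
    (heven : ∀ a, a = a⁻¹ → Even (f a)) {b : A} (hb : f b ≠ 0) :
    2 ≤ ∑ a ∈ {b, b⁻¹}, f a ^ 2 := by
  by_cases h : b = b⁻¹
  · obtain ⟨k, hk⟩ := heven b h
    have hk0 : k ≠ 0 := by rintro rfl; exact hb (by simpa using hk)
    have := Int.one_le_abs hk0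
    rw [← h, Finset.pair_eq_singleton, Finset.sum_singleton, hk, ← sq_abs, ← two_mul, abs_mul]
    norm_num
    nlinarith
  · have := Int.one_le_abs hb
    rw [Finset.sum_pair h, hinv, ← sq_abs]
    nlinarith

/-- If `f` is symmetric, even at involutions, and its squares sum to at most `4`, then two
elements of its support that are not mutually inverse exhaust it, together with their inverses. -/
theorem exists_sum_eq_of_sum_sq_le_four (hinv : ∀ a, f a⁻¹ = f a)
    (heven : ∀ a, a = a⁻¹ → Even (f a)) (hsq : (f.sum fun _ n => n ^ 2) ≤ 4) {b c : A}
    (hb : f b ≠ 0) (hc : f c ≠ 0) (hbc : c ≠ b) (hbc' : c ≠ b⁻¹) :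
    (f.sum fun _ n => n ^ 2) = 4 ∧ ∃ k, (f.sum fun _ n => n) = 4 * k := by
  classical
  have hdisj : Disjoint ({b, b⁻¹} : Finset A) {c, c⁻¹} := by
    rw [Finset.disjoint_left]
    intro a ha ha'
    simp only [Finset.mem_insert, Finset.mem_singleton] at ha ha'
    rcases ha with rfl | rfl <;> rcases ha' with h | h
    · exact hbc h.symm
    · exact hbc' (by rw [h, inv_inv])
    · exact hbc' h.symm
    · exact hbc (inv_injective h).symm
  have h2b := two_le_sum_sq_pair hinv heven hb
  have h2c := two_le_sum_sq_pair hinv heven hc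
  have hle := sum_sq_subset_le (f := f) ({b, b⁻¹} ∪ {c, c⁻¹})
  rw [Finset.sum_union hdisj] at hle
  have hsupp : f.support ⊆ {b, b⁻¹} ∪ {c, c⁻¹} := by
    intro d hd
    by_contra hd'
    have h3 := sum_sq_subset_le (f := f) (insert d ({b, b⁻¹} ∪ {c, c⁻¹}))
    rw [Finset.sum_insert hd', Finset.sum_union hdisj] at h3
    have := sq_pos_of_ne_zero (Finsupp.mem_support_iff.1 hd)
    linarith
  -- An even value cannot have square 2, so the pair is genuine and both values are the same sign
  -- `±1`.
  have hpair : ∀ x, f x ≠ 0 → ∑ a ∈ {x, x⁻¹}, f a ^ 2 = 2 →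
      ∑ a ∈ {x, x⁻¹}, f a = 2 ∨ ∑ a ∈ {x, x⁻¹}, f a = -2 := by
    intro x hx hx2
    by_cases h : x = x⁻¹
    · obtain ⟨k, hk⟩ := heven x h
      rw [← h, Finset.pair_eq_singleton, Finset.sum_singleton, hk] at hx2
      have : 2 * (k * k) = 1 := by linarith
      omega
    · rw [Finset.sum_pair h, hinv] at hx2 ⊢
      have : (f x - 1) * (f x + 1) = 0 := by linarith
      rcases mul_eq_zero.1 this with h | h
      · left; linarith
      · right; linarith
  refine ⟨by linarith, ?_⟩
  rw [Finsupp.sum_of_support_subset _ hsupp _ fun _ _ => rfl, Finset.sum_union hdisj]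
  rcases hpair b hb (by linarith) with h | h <;> rcases hpair c hc (by linarith) with h' | h' <;>
    rw [h, h']
  exacts [⟨1, rfl⟩, ⟨0, rfl⟩, ⟨0, rfl⟩, ⟨-1, rfl⟩]

theorem exists_inverse_pair_of_sum_eq_two (hinv : ∀ a, f a⁻¹ = f a)
    (heven : ∀ a, a = a⁻¹ → Even (f a)) (hsq : (f.sum fun _ n => n ^ 2) ≤ 4)
    (hsum : (f.sum fun _ n => n) = 2) :
    ∃ b, f b ≠ 0 ∧ ∀ c, f c ≠ 0 → c = b ∨ c = b⁻¹ := by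
  obtain ⟨b, hb⟩ : ∃ b, f b ≠ 0 := by
    by_contra! h
    rw [show f = 0 from Finsupp.ext h, Finsupp.sum_zero_index] at hsum
    norm_num at hsum
  refine ⟨b, hb, fun c hc => ?_⟩
  by_contra! h
  obtain ⟨-, k, hk⟩ := exists_sum_eq_of_sum_sq_le_four hinv heven hsq hb hc h.1 h.2
  omega

theorem eq_zero_of_sum_sq_lt_four (hinv : ∀ a, f a⁻¹ = f a)
    (heven : ∀ a, a = a⁻¹ → Even (f a)) (hsq : (f.sum fun _ n => n ^ 2) < 4)
    (hsum : (f.sum fun _ n => n) = 0) : f = 0 := by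
  classical
  by_contra h
  obtain ⟨b, hb⟩ := Finsupp.ne_iff.1 h
  have hsupp : f.support ⊆ {b, b⁻¹} := by
    intro c hc
    by_contra hc'
    simp only [Finset.mem_insert, Finset.mem_singleton, not_or] at hc'
    exact hsq.ne (exists_sum_eq_of_sum_sq_le_four hinv heven hsq.le hb
      (Finsupp.mem_support_iff.1 hc) hc'.1 hc'.2).1
  rw [Finsupp.sum_of_support_subset _ hsupp _ fun _ _ => rfl] at hsum
  by_cases hb' : b = b⁻¹
  · rw [← hb', Finset.pair_eq_singleton, Finset.sum_singleton] at hsum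
    exact hb hsum
  · rw [Finset.sum_pair hb', hinv] at hsum
    exact hb (show f b = 0 by omega)

end Finsupp

/-! ### Conjugacy in an inverting extension -/

section InvertingExtension

variable {G : Type*} [Group G] {A : Subgroup G} {t : G}

theorem Subgroup.index_eq_two_of_closure_insert (hnormal : A.Normal)
    (hgen : Subgroup.closure (insert t (A : Set G)) = ⊤) (hsq : t ^ 2 ∈ A) (ht : t ∉ A) :
    A.index = 2 := by
  have hconj : ∀ a ∈ A, t * a * t⁻¹ ∈ A := fun a ha => hnormal.conj_mem a ha t
  have hconj' : ∀ a ∈ A, t⁻¹ * a * t ∈ A := fun a ha => by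
    simpa using hnormal.conj_mem a ha t⁻¹
  -- `A ∪ tA` is closed under products and inverses.
  have key : ∀ g : G, g ∈ A ∨ t⁻¹ * g ∈ A := by
    intro g
    have hg : g ∈ Subgroup.closure (insert t (A : Set G)) := hgen ▸ Subgroup.mem_top g
    induction hg using Subgroup.closure_induction with
    | mem x hx =>
      rcases hx with rfl | hx
      · right; simp
      · exact Or.inl hx
    | one => exact Or.inl A.one_mem
    | mul x y _ _ hx hy =>
      rcases hx with hx | hx <;> rcases hy with hy | hy
      · exact Or.inl (A.mul_mem hx hy)
      · right
        have := A.mul_mem (hconj' x hx) hy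
        simpa [mul_assoc] using this
      · right
        simpa [mul_assoc] using A.mul_mem hx hy
      · left
        have := A.mul_mem (A.mul_mem (hconj _ hx) hsq) hy
        simpa [mul_assoc, pow_two] using this
    | inv x _ hx =>
      rcases hx with hx | hx
      · exact Or.inl (A.inv_mem hx)
      · right
        have := A.mul_mem (hconj' _ (A.inv_mem hx)) (A.inv_mem hsq)
        simpa [mul_assoc, pow_two] using this
  rw [Subgroup.index_eq_two_iff']
  refine ⟨t⁻¹, fun b => ?_⟩
  rw [xor_iff_or_and_not_and]
  refine ⟨(key b).symm, fun h => ht ?_⟩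
  simpa using A.mul_mem h.2 (A.inv_mem h.1)

theorem Subgroup.conj_eq_inv_of_notMem (hidx : A.index = 2)
    (hcomm : ∀ a ∈ A, ∀ b ∈ A, a * b = b * a) (ht : t ∉ A)
    (hinv : ∀ a ∈ A, t⁻¹ * a * t = a⁻¹) {g : G} (hg : g ∉ A) {a : G} (ha : a ∈ A) :
    g * a * g⁻¹ = a⁻¹ := by
  have hu : t⁻¹ * g ∈ A := (Subgroup.mul_mem_iff_of_index_two hidx).2 (by simp [ht, hg])
  have h1 : (t⁻¹ * g) * a * (t⁻¹ * g)⁻¹ = a := by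
    rw [hcomm _ hu _ ha]; group
  have h2 : g * a * g⁻¹ = t * ((t⁻¹ * g) * a * (t⁻¹ * g)⁻¹) * t⁻¹ := by group
  have h3 := hinv _ (A.inv_mem ha)
  rw [inv_inv] at h3
  rw [h2, h1]
  nth_rewrite 1 [← h3]
  group

theorem Subgroup.exists_sq_of_mem_commutator (hidx : A.index = 2)
    (hcomm : ∀ a ∈ A, ∀ b ∈ A, a * b = b * a)
    (hconj : ∀ g ∉ A, ∀ a ∈ A, g * a * g⁻¹ = a⁻¹)
    {c : G} (hc : c ∈ _root_.commutator G) :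
    ∃ a ∈ A, c = a * a := by
  let N : Subgroup G :=
    { carrier := {c | ∃ a ∈ A, c = a * a}
      one_mem' := ⟨1, A.one_mem, by simp⟩
      mul_mem' := by
        rintro _ _ ⟨a, ha, rfl⟩ ⟨b, hb, rfl⟩
        refine ⟨a * b, A.mul_mem ha hb, ?_⟩
        rw [mul_assoc a b, ← mul_assoc b a b, ← hcomm a ha b hb]
        simp only [mul_assoc]
      inv_mem' := by
        rintro _ ⟨a, ha, rfl⟩
        exact ⟨a⁻¹, A.inv_mem ha, by simp⟩ }
  have hle : _root_.commutator G ≤ N := by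
    rw [_root_.commutator_def, Subgroup.commutator_le]
    intro g _ h _
    rw [commutatorElement_def]
    by_cases hg : g ∈ A <;> by_cases hh : h ∈ A
    · exact ⟨1, A.one_mem, by rw [hcomm g hg h hh]; group⟩
    · refine ⟨g, hg, ?_⟩
      have := hconj h hh _ (A.inv_mem hg)
      rw [inv_inv] at this
      rw [show g * h * g⁻¹ * h⁻¹ = g * (h * g⁻¹ * h⁻¹) by group, this]
    · refine ⟨h⁻¹, A.inv_mem hh, ?_⟩
      rw [hconj g hg h hh]
    -- With `h = g * u`, the commutator of `g` and `h` is `u * u`.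
    · have hu : g⁻¹ * h ∈ A := (Subgroup.mul_mem_iff_of_index_two hidx).2 (by simp [hg, hh])
      refine ⟨g⁻¹ * h, hu, ?_⟩
      have h1 := hconj g hg _ hu
      have h2 := hconj g hg _ (A.inv_mem (A.mul_mem hu hu))
      rw [inv_inv] at h2
      calc g * h * g⁻¹ * h⁻¹ = g * (g * (g⁻¹ * h) * g⁻¹) * (g⁻¹ * h)⁻¹ * g⁻¹ := by group
        _ = g * (g⁻¹ * h * (g⁻¹ * h))⁻¹ * g⁻¹ := by rw [h1]; group
        _ = g⁻¹ * h * (g⁻¹ * h) := h2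
  exact hle hc

/-- Equal images give `h = g * a * a` with `a ∈ A`, and `a⁻¹ * g = g * a` makes this the conjugate
of `g` by `a⁻¹`. -/
theorem Subgroup.isConj_iff_abelianization_eq (hidx : A.index = 2)
    (hcomm : ∀ a ∈ A, ∀ b ∈ A, a * b = b * a)
    (hconj : ∀ g ∉ A, ∀ a ∈ A, g * a * g⁻¹ = a⁻¹)
    {g h : G} (hg : g ∉ A) :
    IsConj g h ↔ Abelianization.of g = Abelianization.of h := by
  constructor
  · intro hgh
    exact isConj_iff_eq.1 (MonoidHom.map_isConj Abelianization.of hgh)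
  · intro heq
    have hmem : g⁻¹ * h ∈ _root_.commutator G := by
      rw [← Abelianization.ker_of, MonoidHom.mem_ker, map_mul, map_inv, heq, inv_mul_cancel]
    obtain ⟨a, ha, hah⟩ := Subgroup.exists_sq_of_mem_commutator hidx hcomm hconj hmem
    refine isConj_iff.2 ⟨a⁻¹, ?_⟩
    calc a⁻¹ * g * a⁻¹⁻¹ = a⁻¹ * (g * a) := by group
      _ = (g * a * g⁻¹) * (g * a) := by rw [hconj g hg a ha]
      _ = g * (a * a) := by group
      _ = h := by rw [← hah]; group

theorem Subgroup.isConj_iff_eq_or_eq_inv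
    (hcomm : ∀ a ∈ A, ∀ b ∈ A, a * b = b * a)
    (hconj : ∀ g ∉ A, ∀ a ∈ A, g * a * g⁻¹ = a⁻¹)
    {a h : G} (ht : t ∉ A) (ha : a ∈ A) :
    IsConj a h ↔ h = a ∨ h = a⁻¹ := by
  rw [isConj_iff]
  constructor
  · rintro ⟨c, rfl⟩
    by_cases hc : c ∈ A
    · left; rw [hcomm c hc a ha]; group
    · right; exact hconj c hc a ha
  · rintro (rfl | rfl)
    · exact ⟨1, by simp⟩
    · exact ⟨t, hconj t ht a ha⟩

end InvertingExtension

/-! ### Induction from a subgroup of index two -/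

section Induced

variable {G : Type*} [Group G] {A : Subgroup G} {t : G}

open Classical in
/-- A character of a subgroup, extended by zero to the whole group. -/
noncomputable def Subgroup.extendByZero {R : Type*} [Zero R] (χ : A → R) (g : G) : R :=
  if h : g ∈ A then χ ⟨g, h⟩ else 0

theorem Subgroup.extendByZero_of_mem {R : Type*} [Zero R] (χ : A → R) {g : G} (h : g ∈ A) :
    Subgroup.extendByZero χ g = χ ⟨g, h⟩ := dif_pos h

theorem Subgroup.extendByZero_of_notMem {R : Type*} [Zero R] (χ : A → R) {g : G} (h : g ∉ A) :
    Subgroup.extendByZero χ g = 0 := dif_neg h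

theorem Subgroup.extendByZero_mul {R : Type*} [Ring R] (χ : A →* R) {g h : G} (hg : g ∈ A) :
    Subgroup.extendByZero χ (g * h) =
      Subgroup.extendByZero χ g * Subgroup.extendByZero χ h := by
  by_cases hh : h ∈ A
  · rw [extendByZero_of_mem _ hg, extendByZero_of_mem _ hh,
      extendByZero_of_mem _ (A.mul_mem hg hh), ← map_mul]
    rfl
  · rw [extendByZero_of_notMem _ hh, extendByZero_of_notMem _
      (fun h' => hh ((A.mul_mem_cancel_left hg).1 h')), mul_zero]

/-- Exactly one of `g` and `g * t` lies in `A`, so one summand survives. This is the entrywise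
product rule for the induced matrices. -/
theorem Subgroup.extendByZero_mul_eq_add {R : Type*} [Ring R] (hidx : A.index = 2) (ht : t ∉ A)
    (χ : A →* R) (g h : G) :
    Subgroup.extendByZero χ (g * h) =
      Subgroup.extendByZero χ g * Subgroup.extendByZero χ h +
        Subgroup.extendByZero χ (g * t) * Subgroup.extendByZero χ (t⁻¹ * h) := by
  by_cases hg : g ∈ A
  · have : g * t ∉ A := by rw [Subgroup.mul_mem_iff_of_index_two hidx]; simp [hg, ht]
    rw [extendByZero_mul _ hg, extendByZero_of_notMem _ this, zero_mul, add_zero]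
  · have : g * t ∈ A := by rw [Subgroup.mul_mem_iff_of_index_two hidx]; simp [hg, ht]
    rw [extendByZero_of_notMem _ hg, zero_mul, zero_add, ← extendByZero_mul _ this]
    group

/-- The representation induced from a character of a subgroup of index two. -/
noncomputable def Subgroup.inducedMatrix {R : Type*} [Ring R] (hidx : A.index = 2) (ht : t ∉ A)
    (χ : A →* R) : G →* Matrix (Fin 2) (Fin 2) R where
  toFun g := !![Subgroup.extendByZero χ g, Subgroup.extendByZero χ (g * t);
    Subgroup.extendByZero χ (t⁻¹ * g), Subgroup.extendByZero χ (t⁻¹ * (g * t))]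
  map_one' := by
    have h1 : Subgroup.extendByZero χ (1 : G) = 1 := by
      rw [extendByZero_of_mem _ A.one_mem]; exact map_one χ
    have ht' : t⁻¹ ∉ A := by simpa using ht
    rw [Matrix.one_fin_two]
    simp [h1, extendByZero_of_notMem _ ht, extendByZero_of_notMem _ ht']
  map_mul' g h := by
    rw [Matrix.mul_fin_two, ← extendByZero_mul_eq_add hidx ht]
    have e1 : g * h * t = g * (h * t) := mul_assoc _ _ _
    have e2 : t⁻¹ * (g * h) = (t⁻¹ * g) * h := (mul_assoc _ _ _).symm
    have e3 : t⁻¹ * (g * h * t) = (t⁻¹ * g) * (h * t) := by group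
    have e4 : t⁻¹ * (g * t) = (t⁻¹ * g) * t := (mul_assoc _ _ _).symm
    rw [e3, e2, e1, e4, ← extendByZero_mul_eq_add hidx ht, ← extendByZero_mul_eq_add hidx ht,
      ← extendByZero_mul_eq_add hidx ht]

end Induced

/-! ### Induced traces as Fourier transforms on `A` -/

section TraceFunction

variable {G : Type*} [Group G] {A : Subgroup G} {t : G}

theorem Finsupp.sum_comapDomain_val {R : Type*} [CommRing R] (f : G →₀ ℤ) (H : A → R) :
    ((f.comapDomain (Subtype.val : A → G) Subtype.val_injective.injOn).sum
      fun a n => (n : R) * H a) = f.sum fun g n => (n : R) * Subgroup.extendByZero H g := by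
  classical
  rw [Finsupp.sum, Finsupp.sum]
  simp only [Finsupp.comapDomain_support, Finsupp.comapDomain_apply]
  have := Finset.sum_preimage' (Subtype.val : A → G) f.support Subtype.val_injective.injOn
    (fun g => (f g : R) * Subgroup.extendByZero H g)
  simp only [Subgroup.extendByZero_of_mem _ (SetLike.coe_mem _)] at this
  rw [this, Finset.sum_filter]
  refine Finset.sum_congr rfl fun g _ => ?_
  split_ifs with hg
  · rfl
  · rw [Subgroup.extendByZero_of_notMem _ (by simpa using hg), mul_zero]

/-- The function `a ↦ f a + f a⁻¹` on a subgroup. -/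
noncomputable def Finsupp.symmetrize (A : Subgroup G) (f : G →₀ ℤ) : A →₀ ℤ :=
  let x := f.comapDomain (Subtype.val : A → G) Subtype.val_injective.injOn
  x + x.mapDomain (·⁻¹)

theorem Finsupp.symmetrize_apply (f : G →₀ ℤ) (a : A) :
    f.symmetrize A a = f a + f (a : G)⁻¹ := by
  have h := Finsupp.mapDomain_apply (inv_injective (G := A))
    (f.comapDomain (Subtype.val : A → G) Subtype.val_injective.injOn) a⁻¹
  rw [inv_inv] at h
  rw [Finsupp.symmetrize, Finsupp.add_apply, h]
  simp

theorem Finsupp.sum_symmetrize {R : Type*} [CommRing R] (f : G →₀ ℤ) (H : A → R) :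
    ((f.symmetrize A).sum fun a n => (n : R) * H a) =
      f.sum fun g n => (n : R) * Subgroup.extendByZero (fun a => H a + H a⁻¹) g := by
  rw [Finsupp.symmetrize, Finsupp.sum_add_index' (by simp) (by intros; push_cast; ring),
    Finsupp.sum_mapDomain_index (by simp) (by intros; push_cast; ring), ← Finsupp.sum_add,
    ← Finsupp.sum_comapDomain_val]
  simp only [mul_add]

/-- The induced character is `χ a + χ a⁻¹` on `A` and zero elsewhere, so the sum is the trace of a 2
× 2 matrix of finite order. -/
theorem Finsupp.norm_sum_symmetrize_le (hidx : A.index = 2) (ht : t ∉ A)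
    (hinv : ∀ a ∈ A, t⁻¹ * a * t = a⁻¹) {α : MonoidAlgebra ℤ G} {n : ℕ} (hn : n ≠ 0)
    (hα : α ^ n = 1) (χ : A →* ℂ) :
    ‖(α.coeff.symmetrize A).sum fun a n => (n : ℂ) * χ a‖ ≤ 2 := by
  let ρ := Subgroup.inducedMatrix hidx ht χ
  have htrace : ∀ g, (ρ g).trace = Subgroup.extendByZero (fun a => χ a + χ a⁻¹) g := by
    intro g
    have h1 : (ρ g).trace =
        Subgroup.extendByZero χ g + Subgroup.extendByZero χ (t⁻¹ * (g * t)) :=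
      Matrix.trace_fin_two_of _ _ _ _
    rw [h1]
    by_cases hg : g ∈ A
    · rw [← mul_assoc, hinv g hg, Subgroup.extendByZero_of_mem _ hg,
        Subgroup.extendByZero_of_mem _ (A.inv_mem hg), Subgroup.extendByZero_of_mem _ hg]
      rfl
    · have : t⁻¹ * (g * t) ∉ A := by
        simp [Subgroup.mul_mem_iff_of_index_two hidx, hg, ht]
      rw [Subgroup.extendByZero_of_notMem _ hg, Subgroup.extendByZero_of_notMem _ this,
        Subgroup.extendByZero_of_notMem _ hg, add_zero]
  have h := Matrix.norm_trace_le_of_pow_eq_one (MonoidAlgebra.lift ℤ _ G ρ α) hn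
    (by rw [← map_pow, hα, map_one])
  rw [Finsupp.sum_symmetrize]
  simp only [← htrace]
  rw [MonoidAlgebra.lift_apply, Finsupp.sum, Matrix.trace_sum] at h
  simp only [Matrix.trace_smul] at h
  simpa [Finsupp.sum] using h

end TraceFunction

/-! ### Unique trace -/

theorem GroupRing.hasUniqueTrace_of_comm {G : Type*} [Group G]
    (hcomm : ∀ g h : G, g * h = h * g) {α : MonoidAlgebra ℤ G} {n : ℕ} (hn : n ≠ 0)
    (hα : α ^ n = 1) (haug : GroupRing.augmentation G α = 1) : GroupRing.HasUniqueTrace α := by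
  classical
  let _ : CommGroup G := { (inferInstance : Group G) with mul_comm := hcomm }
  obtain ⟨g, hg⟩ := GroupRing.exists_sum_mul_eq (MonoidHom.id G) Function.surjective_id hn hα haug
  have htr : ∀ k, GroupRing.classTrace α k = if IsConj k g then 1 else 0 := fun k => by
    rw [GroupRing.classTrace_eq_sum]
    exact hg fun h => if IsConj k h then 1 else 0
  refine ⟨g, by rw [htr, if_pos (IsConj.refl g)]; exact one_ne_zero, fun k hk => ?_⟩
  by_contra h
  exact hk (by rw [htr, if_neg fun h' => h h'.symm])

/-- The symmetrized value is the class trace, doubled when `a = a⁻¹`. -/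
theorem GroupRing.symmetrize_ne_zero_iff {G : Type*} [Group G] {A : Subgroup G} {t : G}
    (hcomm : ∀ a ∈ A, ∀ b ∈ A, a * b = b * a)
    (hconj : ∀ g ∉ A, ∀ a ∈ A, g * a * g⁻¹ = a⁻¹) (ht : t ∉ A) (α : MonoidAlgebra ℤ G) (a : A) :
    α.coeff.symmetrize A a ≠ 0 ↔ GroupRing.classTrace α (a : G) ≠ 0 := by
  classical
  rw [Finsupp.symmetrize_apply, GroupRing.classTrace]
  simp only [Subgroup.isConj_iff_eq_or_eq_inv hcomm hconj ht a.2]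
  have : ∑ h ∈ α.coeff.support with h = (a : G) ∨ h = (a : G)⁻¹, α.coeff h =
      ∑ h ∈ {(a : G), (a : G)⁻¹}, α.coeff h := by
    refine Finset.sum_subset (fun x hx => ?_) fun x hx hx' => ?_
    · simpa using (Finset.mem_filter.1 hx).2
    · by_contra h
      exact hx' (Finset.mem_filter.2 ⟨Finsupp.mem_support_iff.2 h, by simpa using hx⟩)
  rw [this]
  by_cases h : (a : G) = (a : G)⁻¹
  · rw [← h, Finset.pair_eq_singleton, Finset.sum_singleton]
    omega
  · rw [Finset.sum_pair h]

theorem GroupRing.hasUniqueTrace_of_index_two {G : Type*} [Group G] {A : Subgroup G} {t : G}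
    (hidx : A.index = 2) (hcomm : ∀ a ∈ A, ∀ b ∈ A, a * b = b * a) (ht : t ∉ A)
    (hinv : ∀ a ∈ A, t⁻¹ * a * t = a⁻¹) {α : MonoidAlgebra ℤ G} {n : ℕ} (hn : n ≠ 0)
    (hα : α ^ n = 1) (haug : GroupRing.augmentation G α = 1) : GroupRing.HasUniqueTrace α := by
  classical
  have hconj : ∀ g ∉ A, ∀ a ∈ A, g * a * g⁻¹ = a⁻¹ := fun g hg a ha =>
    Subgroup.conj_eq_inv_of_notMem hidx hcomm ht hinv hg ha
  obtain ⟨g, hg⟩ := GroupRing.exists_sum_mul_eq (Abelianization.of (G := G))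
    (QuotientGroup.mk_surjective) hn hα haug
  -- Commutators lie in `A`, so membership in `A` depends only on the image in the abelianization.
  have hmemA : ∀ h k : G, Abelianization.of h = Abelianization.of k → (h ∈ A ↔ k ∈ A) := by
    intro h k hhk
    have hmem : h⁻¹ * k ∈ _root_.commutator G := by
      rw [← Abelianization.ker_of, MonoidHom.mem_ker, map_mul, map_inv, hhk, inv_mul_cancel]
    obtain ⟨a, ha, hah⟩ := Subgroup.exists_sq_of_mem_commutator hidx hcomm hconj hmem
    have h2 : h⁻¹ * k ∈ A := hah ▸ A.mul_mem ha ha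
    simpa [Subgroup.mul_mem_iff_of_index_two hidx] using h2
  have htr : ∀ k ∉ A, GroupRing.classTrace α k = if IsConj k g then 1 else 0 := fun k hk => by
    rw [GroupRing.classTrace_eq_sum]
    simp only [Subgroup.isConj_iff_abelianization_eq hidx hcomm hconj hk]
    exact hg fun h => if Abelianization.of k = h then 1 else 0
  have hsum : ((α.coeff.symmetrize A).sum fun _ n => n) = if g ∈ A then 2 else 0 := by
    have h1 := Finsupp.sum_symmetrize α.coeff (fun _ : A => (1 : ℤ))
    -- Each coefficient on `A` enters the total twice, hence the weight 2 on the image of `A`.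
    have h2 := hg fun q => if ∃ a ∈ A, Abelianization.of a = q then 2 else 0
    have h3 : ∀ h : G, (∃ a ∈ A, Abelianization.of a = Abelianization.of h) ↔ h ∈ A := fun h =>
      ⟨fun ⟨a, ha, hah⟩ => (hmemA a h hah).1 ha, fun hh => ⟨h, hh, rfl⟩⟩
    simp only [h3] at h2
    rw [← h2]
    simpa [Subgroup.extendByZero] using h1
  have htrA : ∀ a : A, α.coeff.symmetrize A a ≠ 0 ↔ GroupRing.classTrace α (a : G) ≠ 0 :=
    GroupRing.symmetrize_ne_zero_iff hcomm hconj ht α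
  let _ : CommGroup A :=
    { (inferInstance : Group A) with mul_comm := fun a b => Subtype.ext (hcomm a a.2 b b.2) }
  have hsym : ∀ a : A, α.coeff.symmetrize A a⁻¹ = α.coeff.symmetrize A a := fun a => by
    rw [Finsupp.symmetrize_apply, Finsupp.symmetrize_apply, Subgroup.coe_inv, inv_inv, add_comm]
  have heven : ∀ a : A, a = a⁻¹ → Even (α.coeff.symmetrize A a) := fun a ha => by
    rw [Finsupp.symmetrize_apply, ← Subgroup.coe_inv, ← ha]
    exact ⟨_, rfl⟩
  obtain ⟨hle, hlt⟩ := Finsupp.sum_sq_le_of_norm_character_le (α.coeff.symmetrize A) (C := 2)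
    fun χ => Finsupp.norm_sum_symmetrize_le hidx ht hinv hn hα (Circle.coeHom.comp χ)
  by_cases hgA : g ∈ A
  · rw [if_pos hgA] at hsum
    have hsq : ((α.coeff.symmetrize A).sum fun _ n => n ^ 2) ≤ 4 := by
      have : (((α.coeff.symmetrize A).sum fun _ n => n ^ 2 : ℤ) : ℝ) ≤ ((4 : ℤ) : ℝ) :=
        hle.trans (by norm_num)
      exact_mod_cast this
    obtain ⟨b, hb, hb'⟩ := Finsupp.exists_inverse_pair_of_sum_eq_two hsym heven hsq hsum
    refine ⟨b, (htrA b).1 hb, fun h hh => ?_⟩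
    by_cases hA : h ∈ A
    · rw [Subgroup.isConj_iff_eq_or_eq_inv hcomm hconj ht b.2]
      rcases hb' ⟨h, hA⟩ ((htrA _).2 hh) with h1 | h1
      · exact Or.inl (congrArg Subtype.val h1)
      · exact Or.inr (congrArg Subtype.val h1)
    · rw [htr h hA] at hh
      have h1 : IsConj h g := by
        by_contra h'
        exact hh (if_neg h')
      rw [Subgroup.isConj_iff_abelianization_eq hidx hcomm hconj hA] at h1
      exact absurd ((hmemA _ _ h1).2 hgA) hA
  · rw [if_neg hgA] at hsum
    have hsq : ((α.coeff.symmetrize A).sum fun _ n => n ^ 2) < 4 := by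
      have h0 : ((α.coeff.symmetrize A).sum fun _ n => (n : ℂ)) = 0 := by
        have := congrArg (Int.cast : ℤ → ℂ) hsum
        simpa [Finsupp.sum] using this
      have : (((α.coeff.symmetrize A).sum fun _ n => n ^ 2 : ℤ) : ℝ) < ((4 : ℤ) : ℝ) :=
        (hlt (by rw [h0]; norm_num)).trans_le (by norm_num)
      exact_mod_cast this
    have hzero := Finsupp.eq_zero_of_sum_sq_lt_four hsym heven hsq hsum
    refine ⟨g, by rw [htr g hgA, if_pos (IsConj.refl g)]; exact one_ne_zero, fun h hh => ?_⟩
    by_cases hA : h ∈ A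
    · exact absurd (by rw [hzero]; rfl) ((htrA ⟨h, hA⟩).2 hh)
    · rw [htr h hA] at hh
      by_contra h'
      exact hh (if_neg fun h1 => h' h1.symm)

theorem mainTheorem2 {G : Type*} [Group G] (A : Subgroup G) (t : G)
    (hnormal : A.Normal)
    (hcomm : ∀ a ∈ A, ∀ b ∈ A, a * b = b * a)
    (hgen : Subgroup.closure (insert t (A : Set G)) = ⊤)
    (hsq : t ^ 2 ∈ A)
    (hinv : ∀ a ∈ A, t⁻¹ * a * t = a⁻¹)
    (p : ℕ) (hp : p.Prime) :
    GroupRing.IsPUT p G := by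
  rintro α hα ⟨n, hn⟩
  have haug := (GroupRing.mem_normalizedUnits α).1 hα
  have hpow : (α : MonoidAlgebra ℤ G) ^ (p ^ n) = 1 := by
    rw [← Units.val_pow_eq_pow_val, ← hn, pow_orderOf_eq_one, Units.val_one]
  have hne : p ^ n ≠ 0 := pow_ne_zero n hp.ne_zero
  by_cases ht : t ∈ A
  · have htop : A = ⊤ := by
      rw [← top_le_iff, ← hgen, Subgroup.closure_le]
      exact Set.insert_subset ht subset_rfl
    refine GroupRing.hasUniqueTrace_of_comm (fun g h => ?_) hne hpow haug
    exact hcomm g (htop ▸ Subgroup.mem_top g) h (htop ▸ Subgroup.mem_top h)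
  · exact GroupRing.hasUniqueTrace_of_index_two
      (Subgroup.index_eq_two_of_closure_insert hnormal hgen hsq ht) hcomm ht hinv hne hpow haug
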